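/- Let $F$ be a field, $n\ge 0$, and let $A,B\in F^{n\times n}$. The minimal ranks of the pencil $A+\lambda B$ are the pair $\rho(A,B)=(r,s)$ with $$s=\min_{(t,u)\in F^2\setminus\{0\}}\operatorname{rank}(tA+uB),\qquad r=\min_{(t',u')\in F^2\setminus \operatorname{span}\{(t^\star,u^\star)\}}\operatorname{rank}(t'A+u'B),$$ where $(t^\star,u^\star)$ is any minimizer in the definition of $s$ (the value of $r$ does not depend on its choice). The pencil is regular if $\det(\mu A+\lambda B)$ is not the zero polynomial in $F[\mu,\lambda]$. Its elementary divisors (finite and infinite, in homogeneous coordinates, up to nonzero scalars) are the powers $p^e$, $e\ge 1$, of irreducible polynomials $p\in F[\mu,\lambda]$ that occur with exact exponent $e$ in the factorization of one of the invariant polynomials $D_{k+1}/D_k$ with $D_{k+1}\neq 0$, where $D_k$ is the greatest common divisor of the $k\times k$ minors of $\mu A+\lambda B$ (and $D_0=1$); the powers of $\mu$ are the infinite elementary divisors. Then $\rho(A,B)=(n,n)$ if and only if $A+\lambda B$ is regular and none of its elementary divisors is a power of a linear form $\alpha\mu+\beta\lambda$ with $(\alpha,\beta)\in F^2\setminus\{0\}$.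 Moreover, if $F=\mathbb{R}$, then $\rho(A,B)=(n,n)$ if and only if there is a matrix $Q\in\mathbb{R}^{n\times n}$ without real eigenvalues such that $A+\lambda B$ is $\mathrm{GL}_n(\mathbb{R})\times\mathrm{GL}_n(\mathbb{R})\times\mathrm{GL}_2(\mathbb{R})$-equivalent to $Q+\lambda E$, where $E$ is the identity matrix; that is, $Q=P(t_{11}A+t_{12}B)U^{\mathsf T}$ and $E=P(t_{21}A+t_{22}B)U^{\mathsf T}$ for some $P,U\in \mathrm{GL}_n(\mathbb{R})$ and $(t_{ij})\in\mathrm{GL}_2(\mathbb{R})$. -/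

import Mathlib

namespace MatrixPencil

/-! An `m × n` pencil `μ A + λ B` over `F` is represented by the pair `(A, B)`; in non-homogeneous
coordinates it reads `A + λ B`. -/

/-- The member `t A + u B` of the pencil, where `v = (t, u)`. -/
def comb {F : Type*} [Field F] {m n : ℕ} (A B : Matrix (Fin m) (Fin n) F) (v : Fin 2 → F) :
    Matrix (Fin m) (Fin n) F :=
  v 0 • A + v 1 • B

/-- `s = min_{(t,u) ≠ 0} rank (t A + u B)`. -/
noncomputable def lowerRank {F : Type*} [Field F] {m n : ℕ} (A B : Matrix (Fin m) (Fin n) F) : ℕ :=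
  sInf {k : ℕ | ∃ v : Fin 2 → F, v ≠ 0 ∧ (comb A B v).rank = k}

/-- `v ≠ 0` attains the minimum that defines `lowerRank`. -/
def IsMinimizer {F : Type*} [Field F] {m n : ℕ} (A B : Matrix (Fin m) (Fin n) F)
    (v : Fin 2 → F) : Prop :=
  v ≠ 0 ∧ (comb A B v).rank = lowerRank A B

/-- `min_{(t',u') ∉ span {v}} rank (t' A + u' B)`. -/
noncomputable def rankOffSpan {F : Type*} [Field F] {m n : ℕ} (A B : Matrix (Fin m) (Fin n) F)
    (v : Fin 2 → F) : ℕ :=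
  sInf {k : ℕ | ∃ w : Fin 2 → F, w ∉ Submodule.span F {v} ∧ (comb A B w).rank = k}

theorem exists_isMinimizer {F : Type*} [Field F] {m n : ℕ} (A B : Matrix (Fin m) (Fin n) F) :
    ∃ v, IsMinimizer A B v := by
  have hne : {k : ℕ | ∃ v : Fin 2 → F, v ≠ 0 ∧ (comb A B v).rank = k}.Nonempty :=
    ⟨_, fun _ => 1, fun h => one_ne_zero (congrFun h 0), rfl⟩
  obtain ⟨v, hv, h⟩ := Nat.sInf_mem hne
  exact ⟨v, hv, h⟩

/-- If two minimizers are not collinear, each is available off the span of the other, and then the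
minimum off the span equals `lowerRank`. -/
theorem rankOffSpan_eq_lowerRank {F : Type*} [Field F] {m n : ℕ} {A B : Matrix (Fin m) (Fin n) F}
    {v w : Fin 2 → F} (hw : IsMinimizer A B w) (h : w ∉ Submodule.span F {v}) :
    rankOffSpan A B v = lowerRank A B := by
  apply le_antisymm
  · exact Nat.sInf_le ⟨w, h, hw.2⟩
  · refine le_csInf ⟨_, w, h, rfl⟩ ?_
    rintro k ⟨x, hx, rfl⟩
    refine Nat.sInf_le ⟨x, ?_, rfl⟩
    rintro rfl
    exact hx (Submodule.zero_mem _)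

/-- The value of `rankOffSpan` does not depend on the minimizer. -/
theorem rankOffSpan_eq {F : Type*} [Field F] {m n : ℕ} {A B : Matrix (Fin m) (Fin n) F}
    {v w : Fin 2 → F} (hv : IsMinimizer A B v) (hw : IsMinimizer A B w) :
    rankOffSpan A B v = rankOffSpan A B w := by
  by_cases h : w ∈ Submodule.span F {v}
  · have hs : Submodule.span F {v} = Submodule.span F {w} := by
      obtain ⟨c, rfl⟩ := Submodule.mem_span_singleton.1 h
      have hc : c ≠ 0 := by
        rintro rfl
        exact hw.1 (zero_smul _ _)
      exact (Submodule.span_singleton_smul_eq (IsUnit.mk0 c hc) v).symm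
    unfold rankOffSpan
    rw [hs]
  · have h' : v ∉ Submodule.span F {w} := by
      intro hvw
      obtain ⟨c, hc⟩ := Submodule.mem_span_singleton.1 hvw
      have hc0 : c ≠ 0 := by
        rintro rfl
        exact hv.1 (by rw [← hc, zero_smul])
      exact h (Submodule.mem_span_singleton.2 ⟨c⁻¹, by rw [← hc, inv_smul_smul₀ hc0]⟩)
    rw [rankOffSpan_eq_lowerRank hw h, rankOffSpan_eq_lowerRank hv h']

/-- The minimal ranks `ρ(A, B) = (r, s)`. The choice of the minimizer is immaterial by
`rankOffSpan_eq`. -/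
noncomputable def minimalRanks {F : Type*} [Field F] {m n : ℕ} (A B : Matrix (Fin m) (Fin n) F) :
    ℕ × ℕ :=
  (rankOffSpan A B (exists_isMinimizer A B).choose, lowerRank A B)

/-- The matrix `μ A + λ B` over `F[μ, λ]`, with `μ = X 0` and `λ = X 1`. -/
noncomputable def homog {F : Type*} [Field F] {m n : ℕ} (A B : Matrix (Fin m) (Fin n) F) :
    Matrix (Fin m) (Fin n) (MvPolynomial (Fin 2) F) :=
  (MvPolynomial.X 0 : MvPolynomial (Fin 2) F) • A.map MvPolynomial.C +
    (MvPolynomial.X 1 : MvPolynomial (Fin 2) F) • B.map MvPolynomial.C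

/-- A square pencil is regular if `det (μ A + λ B)` is not the zero polynomial. -/
def IsRegular {F : Type*} [Field F] {n : ℕ} (A B : Matrix (Fin n) (Fin n) F) : Prop :=
  (homog A B).det ≠ 0

/-- `D` is a `k`-th determinantal divisor of `M`: a greatest common divisor of all the minors of
order `k` of `M`. It is unique up to a unit. -/
def IsDeterminantalDivisor {R : Type*} [CommRing R] {m n : ℕ} (M : Matrix (Fin m) (Fin n) R)
    (k : ℕ) (D : R) : Prop :=
  (∀ (f : Fin k ↪o Fin m) (g : Fin k ↪o Fin n), D ∣ (M.submatrix f g).det) ∧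
    ∀ d : R, (∀ (f : Fin k ↪o Fin m) (g : Fin k ↪o Fin n), d ∣ (M.submatrix f g).det) → d ∣ D

/-- `i` is an invariant polynomial (invariant factor) of `M`: a quotient `D_{k+1} / D_k` of
consecutive determinantal divisors, where `D_{k+1} ≠ 0`. -/
def IsInvariantFactor {R : Type*} [CommRing R] {m n : ℕ} (M : Matrix (Fin m) (Fin n) R)
    (i : R) : Prop :=
  ∃ (k : ℕ) (D D' : R), IsDeterminantalDivisor M k D ∧ IsDeterminantalDivisor M (k + 1) D' ∧
    D' ≠ 0 ∧ D' = D * i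

/-- `q` is an elementary divisor of the pencil, in homogeneous coordinates: `q = p ^ e`, `e ≥ 1`,
where `p` is irreducible over `F` and `p ^ e` is the exact power of `p` in the factorization of an
invariant polynomial of `μ A + λ B`. As usual these are determined up to nonzero scalars.
The divisors that are powers of `μ` are the infinite elementary divisors of `A + λ B`; setting
`μ = 1` in the others yields the finite ones. -/
def IsElementaryDivisor {F : Type*} [Field F] {m n : ℕ} (A B : Matrix (Fin m) (Fin n) F)
    (q : MvPolynomial (Fin 2) F) : Prop :=
  ∃ (i p : MvPolynomial (Fin 2) F) (e : ℕ), IsInvariantFactor (homog A B) i ∧ Irreducible p ∧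
    1 ≤ e ∧ p ^ e ∣ i ∧ ¬ p ^ (e + 1) ∣ i ∧ q = p ^ e

/-- `q` is a power of a nonzero linear form `α μ + β λ` with coefficients in `F`. -/
def IsPowerOfLinearForm {F : Type*} [Field F] (q : MvPolynomial (Fin 2) F) : Prop :=
  ∃ (α β : F) (e : ℕ), (α, β) ≠ (0, 0) ∧
    q = (MvPolynomial.C α * MvPolynomial.X 0 + MvPolynomial.C β * MvPolynomial.X 1) ^ e

/-- The action of `GL_m(F) × GL_n(F) × GL_2(F)` on `m × n` pencils:
`(P, U, T) · (μ A + λ B) = μ P (t₁₁ A + t₁₂ B) Uᵀ + λ P (t₂₁ A + t₂₂ B) Uᵀ`. -/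
def act {F : Type*} [Field F] {m n : ℕ} (P : Matrix.GeneralLinearGroup (Fin m) F)
    (U : Matrix.GeneralLinearGroup (Fin n) F) (T : Matrix.GeneralLinearGroup (Fin 2) F)
    (A B : Matrix (Fin m) (Fin n) F) : Matrix (Fin m) (Fin n) F × Matrix (Fin m) (Fin n) F :=
  (P.val * (T.val 0 0 • A + T.val 0 1 • B) * U.val.transpose,
    P.val * (T.val 1 0 • A + T.val 1 1 • B) * U.val.transpose)

/-- The orbit `𝒪(A, B)`. -/
def orbit {F : Type*} [Field F] {m n : ℕ} (A B : Matrix (Fin m) (Fin n) F) :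
    Set (Matrix (Fin m) (Fin n) F × Matrix (Fin m) (Fin n) F) :=
  {C | ∃ P U T, C = act P U T A B}

end MatrixPencil

/-! Both statements reduce to one condition: every nonzero combination of the two matrices is
nonsingular (`minimalRanks_eq_iff`), so the form det(μA + λB) has no zero in F² other than possibly
the origin. A nontrivial zero (t, u) yields the linear factor uμ - tλ (`linearForm_dvd_det_homog`).
If the determinant is nonzero, such a factor divides some invariant factor
(`exists_isInvariantFactor_dvd`) and so gives an elementary divisor. Conversely, invariant factors
divide the determinant (`IsInvariantFactor.dvd_det`), so a linear elementary divisor forces a zero.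
For the normal form, the condition makes B invertible and Q = B⁻¹A works; conversely, an invertible
T only permutes the nonzero coefficient vectors. This part holds over every field. -/

open MvPolynomial

namespace MatrixPencil

/-! ### Determinantal divisors and invariant factors -/

section Minors

variable {R : Type*} [CommRing R] {m n : ℕ}

theorem dvd_minor_succ {M : Matrix (Fin m) (Fin n) R} {k : ℕ} {d : R}
    (h : ∀ (f : Fin k ↪o Fin m) (g : Fin k ↪o Fin n), d ∣ (M.submatrix f g).det)
    (f : Fin (k + 1) ↪o Fin m) (g : Fin (k + 1) ↪o Fin n) : d ∣ (M.submatrix f g).det := by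
  rw [Matrix.det_succ_row_zero]
  exact Finset.dvd_sum fun j _ => Dvd.dvd.mul_left
    (h ((Fin.succOrderEmb k).trans f) ((Fin.succAboveOrderEmb j).trans g)) _

theorem dvd_minor_of_le {M : Matrix (Fin m) (Fin n) R} {k l : ℕ} (hkl : k ≤ l) {d : R}
    (h : ∀ (f : Fin k ↪o Fin m) (g : Fin k ↪o Fin n), d ∣ (M.submatrix f g).det) :
    ∀ (f : Fin l ↪o Fin m) (g : Fin l ↪o Fin n), d ∣ (M.submatrix f g).det := by
  induction l, hkl using Nat.le_induction with
  | base => exact h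
  | succ l _ ih => exact dvd_minor_succ ih

theorem IsDeterminantalDivisor.dvd_of_le {M : Matrix (Fin m) (Fin n) R} {k l : ℕ} {D D' : R}
    (hD : IsDeterminantalDivisor M k D) (hD' : IsDeterminantalDivisor M l D') (hkl : k ≤ l) :
    D ∣ D' :=
  hD'.2 D (dvd_minor_of_le hkl hD.1)

/-- There are no minors of that order, so 0 is vacuously a common divisor. -/
theorem IsDeterminantalDivisor.eq_zero_of_lt {M : Matrix (Fin m) (Fin n) R} {k : ℕ} {D : R}
    (hD : IsDeterminantalDivisor M k D) (hk : m < k) : D = 0 := by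
  refine zero_dvd_iff.1 (hD.2 0 fun f => ?_)
  have := Fintype.card_le_of_embedding f.toEmbedding
  simp only [Fintype.card_fin] at this
  omega

theorem isDeterminantalDivisor_det (M : Matrix (Fin n) (Fin n) R) :
    IsDeterminantalDivisor M n M.det := by
  have key (f : Fin n ↪o Fin n) : (f : Fin n → Fin n) = id :=
    f.strictMono.range_inj strictMono_id |>.1
      ((Finite.surjective_of_injective f.injective).range_eq.trans Set.range_id.symm)
  refine ⟨fun f g => ?_, fun d hd => ?_⟩
  · rw [key f, key g, Matrix.submatrix_id_id]
  · simpa using hd (RelEmbedding.refl _) (RelEmbedding.refl _)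

theorem isDeterminantalDivisor_zero (M : Matrix (Fin m) (Fin n) R) :
    IsDeterminantalDivisor M 0 1 := by
  refine ⟨fun _ _ => one_dvd _, fun d hd => ?_⟩
  simpa using hd (OrderEmbedding.ofIsEmpty) (OrderEmbedding.ofIsEmpty)

theorem exists_isDeterminantalDivisor [IsDomain R] [UniqueFactorizationMonoid R]
    (M : Matrix (Fin m) (Fin n) R) (k : ℕ) : ∃ D, IsDeterminantalDivisor M k D := by
  classical
  let _ : StrongNormalizationMonoid R := UniqueFactorizationMonoid.strongNormalizationMonoid
  let _ := UniqueFactorizationMonoid.toNormalizedGCDMonoid R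
  let _ := Fintype.ofFinite ((Fin k ↪o Fin m) × (Fin k ↪o Fin n))
  refine ⟨Finset.univ.gcd fun p : (Fin k ↪o Fin m) × (Fin k ↪o Fin n) =>
    (M.submatrix p.1 p.2).det, fun f g => ?_, fun d hd => ?_⟩
  · exact Finset.gcd_dvd (Finset.mem_univ (f, g))
  · exact Finset.dvd_gcd fun p _ => hd p.1 p.2

theorem IsInvariantFactor.dvd_det {M : Matrix (Fin n) (Fin n) R} {i : R}
    (hi : IsInvariantFactor M i) : i ∣ M.det := by
  obtain ⟨k, D, D', -, hD', h0, rfl⟩ := hi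
  refine (Dvd.intro_left D rfl).trans (hD'.dvd_of_le (isDeterminantalDivisor_det M) ?_)
  by_contra hk
  exact h0 (hD'.eq_zero_of_lt (not_le.1 hk))

/-- A prime factor of a nonzero determinant divides one of the invariant factors. -/
theorem exists_isInvariantFactor_dvd [IsDomain R] [UniqueFactorizationMonoid R]
    {M : Matrix (Fin n) (Fin n) R} (hM : M.det ≠ 0) {p : R} (hp : Prime p) (h : p ∣ M.det) :
    ∃ i, IsInvariantFactor M i ∧ i ≠ 0 ∧ p ∣ i := by
  classical
  -- For the least k with p ∣ D_k, p does not divide D_{k-1}, hence it divides the quotient. The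
  -- case k = 0 is excluded because D_0 is a unit.
  have hex : ∃ k, ∃ D, IsDeterminantalDivisor M k D ∧ p ∣ D :=
    ⟨n, _, isDeterminantalDivisor_det M, h⟩
  have hle : Nat.find hex ≤ n := Nat.find_min' hex ⟨_, isDeterminantalDivisor_det M, h⟩
  obtain ⟨D', hD', hpD'⟩ := Nat.find_spec hex
  have hmin : ∀ k < Nat.find hex, ∀ D, IsDeterminantalDivisor M k D → ¬ p ∣ D :=
    fun k hk D hD hpD => Nat.find_min hex hk ⟨D, hD, hpD⟩
  generalize Nat.find hex = k at *
  rcases k with _ | k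
  · exact absurd (isUnit_of_dvd_one (hpD'.trans (hD'.dvd_of_le
      (isDeterminantalDivisor_zero M) le_rfl))) hp.not_isUnit
  · have hD'0 : D' ≠ 0 := by
      rintro rfl
      exact hM (zero_dvd_iff.1 (hD'.dvd_of_le (isDeterminantalDivisor_det M) hle))
    obtain ⟨D, hD⟩ := exists_isDeterminantalDivisor M k
    obtain ⟨i, rfl⟩ := hD.dvd_of_le hD' k.le_succ
    exact ⟨i, ⟨k, D, _, hD, hD', hD'0, rfl⟩, right_ne_zero_of_mul hD'0,
      (hp.dvd_or_dvd hpD').resolve_left (hmin k k.lt_succ_self D hD)⟩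

end Minors

/-! ### Minimal ranks and linear factors of the determinant -/

variable {F : Type*} [Field F] {n : ℕ}

theorem rank_eq_iff_det_ne_zero (M : Matrix (Fin n) (Fin n) F) : M.rank = n ↔ M.det ≠ 0 := by
  constructor
  · intro h
    rw [← isUnit_iff_ne_zero, ← Matrix.isUnit_iff_isUnit_det,
      ← Matrix.linearIndependent_rows_iff_isUnit, linearIndependent_iff_card_eq_finrank_span,
      Fintype.card_fin, Set.finrank, ← Matrix.rank_eq_finrank_span_row, h]
  · intro h
    rw [Matrix.rank_of_isUnit M ((Matrix.isUnit_iff_isUnit_det M).2 (isUnit_iff_ne_zero.2 h)),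
      Fintype.card_fin]

theorem exists_notMem_span_singleton (v : Fin 2 → F) : ∃ w, w ∉ Submodule.span F {v} := by
  by_contra! h
  have := finrank_span_le_card (R := F) ({v} : Set (Fin 2 → F))
  rw [(Submodule.eq_top_iff' (p := Submodule.span F {v})).2 h] at this
  simp at this

theorem minimalRanks_eq_iff (A B : Matrix (Fin n) (Fin n) F) :
    minimalRanks A B = (n, n) ↔ ∀ v, v ≠ 0 → (comb A B v).det ≠ 0 := by
  constructor
  · intro h v hv
    rw [← rank_eq_iff_det_ne_zero]
    refine le_antisymm (Matrix.rank_le_width _) ?_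
    have hs : lowerRank A B = n := congrArg Prod.snd h
    conv_lhs => rw [← hs]
    exact Nat.sInf_le ⟨v, hv, rfl⟩
  · intro h
    have hr : ∀ v, v ≠ 0 → (comb A B v).rank = n := fun v hv =>
      (rank_eq_iff_det_ne_zero _).2 (h v hv)
    have hmin := (exists_isMinimizer A B).choose_spec
    generalize hv : (exists_isMinimizer A B).choose = v at hmin
    -- All nonzero vectors are minimizers here, so any w off the span forces r = s.
    obtain ⟨w, hw⟩ := exists_notMem_span_singleton v
    have hs : lowerRank A B = n := by rw [← hmin.2, hr v hmin.1]
    have hw0 : w ≠ 0 := by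
      rintro rfl
      exact hw (Submodule.zero_mem _)
    rw [minimalRanks, hv, hs, rankOffSpan_eq_lowerRank ⟨hw0, by rw [hr w hw0, hs]⟩ hw, hs]

theorem eval_det_homog (A B : Matrix (Fin n) (Fin n) F) (v : Fin 2 → F) :
    eval v (homog A B).det = (comb A B v).det := by
  rw [RingHom.map_det]
  congr 1
  ext i j
  simp [homog, comb]

/-- If one matrix is congruent to a multiple of a singular one modulo `l`, then `l` divides its
determinant. -/
theorem dvd_det_of_eq_smul_add_smul {R : Type*} [CommRing R] {M N K : Matrix (Fin n) (Fin n) R}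
    {x l : R} (h : M = x • N + l • K) (hN : N.det = 0) : l ∣ M.det := by
  rw [← Ideal.mem_span_singleton, ← Ideal.Quotient.eq_zero_iff_mem, RingHom.map_det]
  have hl : Ideal.Quotient.mk (Ideal.span {l}) l = 0 :=
    Ideal.Quotient.eq_zero_iff_mem.2 (Ideal.mem_span_singleton_self l)
  have : (Ideal.Quotient.mk (Ideal.span {l})).mapMatrix M =
      (Ideal.Quotient.mk (Ideal.span {l})).mapMatrix (x • N) := by
    ext i j
    simp [h, hl]
  rw [this, ← RingHom.map_det, Matrix.det_smul, hN, mul_zero, map_zero]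

/-- With l = v₁μ - v₀λ and N = v₀A + v₁B, one has v₁(μA + λB) = λN + lA and v₀(μA + λB) = μN - lB.
Whichever vᵢ is nonzero, the pencil is, up to a unit, a multiple of the singular N modulo l. -/
theorem linearForm_dvd_det_homog {A B : Matrix (Fin n) (Fin n) F} {v : Fin 2 → F} (hv : v ≠ 0)
    (h : (comb A B v).det = 0) :
    (C (v 1) * X 0 + C (-v 0) * X 1 : MvPolynomial (Fin 2) F) ∣ (homog A B).det := by
  have hN : ((comb A B v).map C : Matrix _ _ (MvPolynomial (Fin 2) F)).det = 0 := by
    rw [← RingHom.mapMatrix_apply, ← RingHom.map_det, h, map_zero]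
  have of_smul {c : F} (hc : c ≠ 0) {l : MvPolynomial (Fin 2) F}
      (hl : l ∣ ((C c : MvPolynomial (Fin 2) F) • homog A B).det) : l ∣ (homog A B).det := by
    rw [Matrix.det_smul] at hl
    exact (((isUnit_iff_ne_zero.2 hc).map C).pow _).dvd_mul_left.1 hl
  by_cases h0 : v 0 = 0
  · have h1 : v 1 ≠ 0 := fun h1 => hv (by ext i; fin_cases i <;> assumption)
    refine of_smul h1 (dvd_det_of_eq_smul_add_smul (x := X 1) (K := A.map C) ?_ hN)
    ext1 i j
    simp [homog, comb]
    ring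
  · refine of_smul h0 (dvd_det_of_eq_smul_add_smul (x := X 0) (K := -B.map C) ?_ hN)
    ext1 i j
    simp [homog, comb]
    ring

theorem irreducible_linearForm {α β : F} (h : (α, β) ≠ (0, 0)) :
    Irreducible (C α * X 0 + C β * X 1 : MvPolynomial (Fin 2) F) := by
  have c0 : coeff (Finsupp.single 0 1) (C α * X 0 + C β * X 1 : MvPolynomial (Fin 2) F) = α := by
    simp [coeff_C_mul, coeff_X, Finsupp.single_left_inj]
  have c1 : coeff (Finsupp.single 1 1) (C α * X 0 + C β * X 1 : MvPolynomial (Fin 2) F) = β := by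
    simp [coeff_C_mul, coeff_X, Finsupp.single_left_inj]
  have hne : α ≠ 0 ∨ β ≠ 0 := by
    by_contra! h'
    exact h (Prod.ext h'.1 h'.2)
  apply irreducible_of_totalDegree_eq_one
  · apply le_antisymm
    · exact (((isHomogeneous_C_mul_X α 0).add (isHomogeneous_C_mul_X β 1)).totalDegree_le)
    · rcases hne with h0 | h0
      · simpa using le_totalDegree (mem_support_iff.2 (c0.trans_ne h0))
      · simpa using le_totalDegree (mem_support_iff.2 (c1.trans_ne h0))
  · intro x hx
    rw [isUnit_iff_ne_zero]
    rintro rfl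
    rcases hne with h0 | h0
    · exact h0 (c0 ▸ zero_dvd_iff.1 (hx (Finsupp.single 0 1)))
    · exact h0 (c1 ▸ zero_dvd_iff.1 (hx (Finsupp.single 1 1)))

theorem forall_det_comb_ne_zero_iff (A B : Matrix (Fin n) (Fin n) F) :
    (∀ v, v ≠ 0 → (comb A B v).det ≠ 0) ↔
      IsRegular A B ∧ ∀ q : MvPolynomial (Fin 2) F, IsElementaryDivisor A B q →
        ¬ IsPowerOfLinearForm q := by
  constructor
  · intro h
    refine ⟨fun h0 => ?_, ?_⟩
    · refine h (fun _ => 1) (fun h1 => one_ne_zero (congrFun h1 0)) ?_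
      rw [← eval_det_homog, h0, map_zero]
    · rintro q ⟨i, p, e, hi, hp, he, hpe, -, rfl⟩ ⟨α, β, k, hαβ, hk⟩
      -- `IsPowerOfLinearForm` admits exponent 0, which would make p a unit.
      have hk0 : k ≠ 0 := by
        rintro rfl
        rw [pow_zero] at hk
        exact hp.not_isUnit ((isUnit_pow_iff (by omega)).1 (hk ▸ isUnit_one))
      have hdvd : (C α * X 0 + C β * X 1 : MvPolynomial (Fin 2) F) ∣ (homog A B).det :=
        (dvd_pow_self _ hk0).trans (hk ▸ hpe.trans hi.dvd_det)
      -- The point (β, -α) is a zero of αμ + βλ.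
      have hv : (![β, -α] : Fin 2 → F) ≠ 0 := fun hv => hαβ <| by
        simpa [and_comm] using hv
      refine h _ hv ?_
      rw [← eval_det_homog]
      have := map_dvd (eval ![β, -α]) hdvd
      simpa [mul_comm α β] using this
  · rintro ⟨hreg, hel⟩ v hv hdet
    have hl := linearForm_dvd_det_homog hv hdet
    have hne : (v 1, -v 0) ≠ (0, 0) := fun h0 => hv <| by
      simp only [Prod.mk.injEq, neg_eq_zero] at h0
      ext i
      fin_cases i
      exacts [h0.2, h0.1]
    have hirr := irreducible_linearForm hne
    obtain ⟨i, hi, hi0, hli⟩ := exists_isInvariantFactor_dvd hreg hirr.prime hl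
    have hfin := FiniteMultiplicity.of_not_isUnit hirr.not_isUnit hi0
    refine hel _ ⟨i, _, _, hi, hirr, ?_, pow_multiplicity_dvd _ _,
      hfin.not_pow_dvd_of_multiplicity_lt (Nat.lt_succ_self _), rfl⟩ ⟨_, _, _, hne, rfl⟩
    exact hfin.le_multiplicity_of_pow_dvd (by rwa [pow_one])

/-! ### Eigenvalues and the normal form (Q, 1) -/

theorem hasEigenvalue_toLin'_iff_det (Q : Matrix (Fin n) (Fin n) F) (x : F) :
    Module.End.HasEigenvalue (Matrix.toLin' Q) x ↔ (Q - x • 1).det = 0 := by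
  rw [Module.End.hasEigenvalue_iff_mem_spectrum, Matrix.spectrum_toLin', spectrum.mem_iff,
    ← IsUnit.sub_iff, Matrix.isUnit_iff_isUnit_det, isUnit_iff_ne_zero, not_not,
    Algebra.algebraMap_eq_smul_one]

theorem forall_det_comb_one_ne_zero {Q : Matrix (Fin n) (Fin n) F}
    (hQ : ∀ x : F, ¬ Module.End.HasEigenvalue (Matrix.toLin' Q) x) {v : Fin 2 → F} (hv : v ≠ 0) :
    (comb Q 1 v).det ≠ 0 := by
  by_cases h0 : v 0 = 0
  · have h1 : v 1 ≠ 0 := fun h1 => hv (by ext i; fin_cases i <;> assumption)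
    simp [comb, h0, h1]
  · have : comb Q 1 v = v 0 • (Q - (-(v 1 / v 0)) • 1) := by
      rw [comb, smul_sub, smul_smul, mul_neg, mul_div_cancel₀ _ h0, neg_smul, sub_neg_eq_add]
    rw [this, Matrix.det_smul]
    exact mul_ne_zero (pow_ne_zero _ h0) fun h => hQ _ ((hasEigenvalue_toLin'_iff_det _ _).2 h)

theorem forall_det_comb_ne_zero_iff_exists_orbit (A B : Matrix (Fin n) (Fin n) F) :
    (∀ v, v ≠ 0 → (comb A B v).det ≠ 0) ↔
      ∃ Q : Matrix (Fin n) (Fin n) F, (Q, (1 : Matrix (Fin n) (Fin n) F)) ∈ orbit A B ∧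
        ∀ x : F, ¬ Module.End.HasEigenvalue (Matrix.toLin' Q) x := by
  constructor
  · intro h
    have hB : B.det ≠ 0 := by
      simpa [comb] using h ![0, 1] (fun h0 => one_ne_zero (congrFun h0 1))
    have hBu : IsUnit B.det := isUnit_iff_ne_zero.2 hB
    refine ⟨B⁻¹ * A, ⟨(Matrix.GeneralLinearGroup.mkOfDetNeZero B hB)⁻¹, 1, 1, ?_⟩, fun x hx => ?_⟩
    · simp [act, Matrix.coe_units_inv, Matrix.GeneralLinearGroup.mkOfDetNeZero,
        Matrix.nonsing_inv_mul B hBu]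
    · rw [hasEigenvalue_toLin'_iff_det] at hx
      refine h ![1, -x] (fun h0 => one_ne_zero (congrFun h0 0)) ?_
      have : comb A B ![1, -x] = B * (B⁻¹ * A - x • 1) := by
        rw [mul_sub, Matrix.mul_nonsing_inv_cancel_left _ _ hBu, Matrix.mul_smul, mul_one]
        simp [comb, sub_eq_add_neg]
      rw [this, Matrix.det_mul, hx, mul_zero]
  · rintro ⟨Q, ⟨P, U, T, h⟩, hQ⟩ v hv hdet
    -- Writing v = wT turns the combination of (A, B) at v into that of (Q, 1) at w, up to the
    -- factors P and Uᵀ.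
    obtain ⟨w, rfl⟩ : ∃ w, Matrix.vecMul w T.val = v :=
      ⟨Matrix.vecMul v (T⁻¹).val, by rw [Matrix.vecMul_vecMul]; simp⟩
    have hw : w ≠ 0 := by
      rintro rfl
      exact hv (Matrix.zero_vecMul _)
    obtain ⟨h1, h2⟩ := Prod.ext_iff.1 h
    refine forall_det_comb_one_ne_zero hQ hw ?_
    have : comb Q 1 w = P.val * comb A B (Matrix.vecMul w T.val) * U.val.transpose := by
      have hc : comb A B (Matrix.vecMul w T.val) =
          w 0 • (T.val 0 0 • A + T.val 0 1 • B) + w 1 • (T.val 1 0 • A + T.val 1 1 • B) := by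
        simp only [comb, Matrix.vecMul, dotProduct, Fin.sum_univ_two]
        module
      rw [comb, show Q = P.val * _ * U.val.transpose from h1,
        show (1 : Matrix (Fin n) (Fin n) F) = P.val * _ * U.val.transpose from h2, hc,
        Matrix.mul_add P.val (w 0 • _), Matrix.add_mul, Matrix.mul_smul, Matrix.mul_smul,
        Matrix.smul_mul, Matrix.smul_mul]
    rw [this, Matrix.det_mul, Matrix.det_mul, hdet, mul_zero, zero_mul]

end MatrixPencil

theorem mainTheorem5 {F : Type*} [Field F] (n : ℕ) (A B : Matrix (Fin n) (Fin n) F)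
    (A' B' : Matrix (Fin n) (Fin n) ℝ) :
    (MatrixPencil.minimalRanks A B = (n, n) ↔
      MatrixPencil.IsRegular A B ∧
        ∀ q : MvPolynomial (Fin 2) F, MatrixPencil.IsElementaryDivisor A B q →
          ¬ MatrixPencil.IsPowerOfLinearForm q) ∧
    (MatrixPencil.minimalRanks A' B' = (n, n) ↔
      ∃ Q : Matrix (Fin n) (Fin n) ℝ,
        (Q, (1 : Matrix (Fin n) (Fin n) ℝ)) ∈ MatrixPencil.orbit A' B' ∧
          ∀ x : ℝ, ¬ Module.End.HasEigenvalue (Matrix.toLin' Q) x) :=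
  ⟨(MatrixPencil.minimalRanks_eq_iff A B).trans (MatrixPencil.forall_det_comb_ne_zero_iff A B),
    (MatrixPencil.minimalRanks_eq_iff A' B').trans
      (MatrixPencil.forall_det_comb_ne_zero_iff_exists_orbit A' B')⟩
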